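/- Let $\mathcal M$ be a Markov decision process with finite state space $S$, finite action space $A$ (all actions available in all states), initial distribution $\mu_0$, transition probabilities $p_a(i,j)$ and payoff distributions with finite means $r_a(i)$. Suppose that $\mathcal M$ is unichain: for each pure policy $\pi:S\to A$ the matrix $(p_{\pi(i)}(i,j))_{i,j\in S}$ is irreducible. Let $V(\pi)=\sum_{i}\mu_\pi(i)\,r_{\pi(i)}(i)$, where $\mu_\pi$ is the invariant distribution of this matrix, let $V^*=\max_\pi V(\pi)$ over all pure policies, and call a pure policy $\pi$ optimal if $V(\pi)=V^*$. Let $\Pi^*$ be a set of optimal pure policies. Let $\sigma$ be any policy that at each visit to each state $i$ randomly chooses an action $a$ such that $a=\pi(i)$ for some $\pi\in\Pi^*$; the probabilities with which these actions are chosen may depend arbitrarily on the time and on all past states, actions and payoffs, and neither these probabilities nor the relative frequencies of the chosen actions need converge. Then $\sigma$ is optimal: if $X_t$, $A_t$, $R_t$ are the state, action and payoff at time $t$ under $\sigma$, then every $R_t$ is integrable and $$\lim_{n\to\infty}\mathbb E\Big[\frac1n\sum_{t=0}^{n-1}R_t\Big]=V^*,$$ and no randomized history-dependent policy has a long-run expected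 average payoff above $V^*$, i.e. for every such policy the upper limit of these expected averages is at most $V^*$. Moreover, almost surely, the average rewards along the trajectory converge to the optimal value: $$\lim_{n\to\infty}\frac1n\sum_{t=0}^{n-1}r_{A_t}(X_t)=\lim_{n\to\infty}\sum_{i\in S}\mu_n(i)\sum_{a\in A}\lambda_i^n(a)\,r_a(i)=V^*,$$ where $\mu_n(i)$ is the relative frequency of visits to $i$ among the first $n$ steps and $\lambda_i^n(a)$ is the relative frequency of the choice of $a$ at these visits. -/

import Mathlib

open MeasureTheory ProbabilityTheory Filter Topology

/-- A Markov decision process with states `S` and actions `A` (every action is available in every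
state): an initial distribution, transition probabilities `p_a(i, j)`, and for each action `a` and
state `i` a payoff distribution on `ℝ` that has a (finite) mean. -/
structure MDP (S A : Type*) where
  /-- the initial distribution -/
  init : PMF S
  /-- `trans a i` is the distribution of the next state when action `a` is chosen in state `i` -/
  trans : A → S → PMF S
  /-- `payoff a i` is the distribution of the random reward for choosing action `a` in state `i` -/
  payoff : A → S → Measure ℝ
  payoff_prob : ∀ a i, IsProbabilityMeasure (payoff a i)
  payoff_integrable : ∀ a i, Integrable (fun x : ℝ => x) (payoff a i)

/-- What happens at one time step: the state, the action chosen in it, the payoff received. -/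
abbrev Stage (S A : Type*) := S × A × ℝ

/-- A general (history-dependent, randomized) policy. At time `n` the action is drawn from a
distribution that may depend on all the states, actions and payoffs at the times `0, …, n - 1`
and on the state at time `n`. -/
structure Policy (S A : Type*) [MeasurableSpace S] [MeasurableSpace A] where
  /-- the distribution of the action at time `n`, given the past and the current state -/
  choose : (n : ℕ) → Kernel ((Fin n → Stage S A) × S) A
  markov : ∀ n, IsMarkovKernel (choose n)

/-- The policy chooses at each visit (that is, at each time and after each past) in each state `i`
randomly an action of the form `π i` with `π ∈ Ps`. Nothing is assumed on how the probabilities of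
these actions vary with the time and with the past. -/
def Policy.Mixes {S A : Type*} [MeasurableSpace S] [MeasurableSpace A] (σ : Policy S A)
    (Ps : Set (S → A)) : Prop :=
  ∀ (n : ℕ) (past : Fin n → Stage S A) (i : S),
    ∀ᵐ a ∂(σ.choose n (past, i)), ∃ π ∈ Ps, a = π i

namespace MDP

section Pure

variable {S A : Type*} (M : MDP S A)

/-- The transition probability `p_a(i, j)`. -/
noncomputable def prob (a : A) (i j : S) : ℝ := (M.trans a i j).toReal

/-- The mean reward `r_a(i)`. -/
noncomputable def meanReward (a : A) (i : S) : ℝ := ∫ x, x ∂(M.payoff a i)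

/-- The transition matrix of the Markov chain induced by the pure policy `π`. -/
noncomputable def matrix (π : S → A) : Matrix S S ℝ := fun i j => M.prob (π i) i j

/-- The process is unichain: every pure policy induces an irreducible Markov chain. -/
def IsUnichain : Prop := ∀ π : S → A, (M.matrix π).IsIrreducible

variable [Fintype S]

/-- `μ` is an invariant distribution of the Markov chain induced by `π`. -/
def IsInvariant (π : S → A) (μ : S → ℝ) : Prop :=
  μ ∈ stdSimplex ℝ S ∧ Matrix.vecMul μ (M.matrix π) = μ

theorem sum_prob (a : A) (i : S) : ∑ j, M.prob a i j = 1 := by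
  have h := (M.trans a i).tsum_coe
  rw [tsum_fintype] at h
  unfold prob
  rw [← ENNReal.toReal_sum (fun j _ => (M.trans a i).apply_ne_top j), h]
  simp

theorem vecMul_mem (π : S → A) {x : S → ℝ} (hx : x ∈ stdSimplex ℝ S) :
    Matrix.vecMul x (M.matrix π) ∈ stdSimplex ℝ S := by
  refine ⟨fun j => Finset.sum_nonneg fun i _ =>
    mul_nonneg (hx.1 i) ENNReal.toReal_nonneg, ?_⟩
  simp only [Matrix.vecMul, dotProduct, matrix]
  rw [Finset.sum_comm]
  simp only [← Finset.mul_sum, sum_prob, mul_one]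
  exact hx.2

/-- Every pure policy has an invariant distribution. -/
theorem exists_isInvariant (π : S → A) : ∃ μ, M.IsInvariant π μ := by
  classical
  obtain ⟨s, -⟩ := M.init.support_nonempty
  let f : (S → ℝ) →ₗ[ℝ] (S → ℝ) := Matrix.vecMulLinear (M.matrix π)
  have hfS : ∀ x ∈ stdSimplex ℝ S, f x ∈ stdSimplex ℝ S := fun x hx => M.vecMul_mem π hx
  let e : ℕ → S → ℝ := fun n => (f ^ n) (Pi.single s 1)
  have he : ∀ n, e n ∈ stdSimplex ℝ S := by
    intro n
    induction n with
    | zero => exact single_mem_stdSimplex ℝ s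
    | succ n ih =>
      have : e (n + 1) = f (e n) := by simp [e, pow_succ']
      rw [this]; exact hfS _ ih
  let x : ℕ → S → ℝ := fun n => ((n : ℝ) + 1)⁻¹ • ∑ k ∈ Finset.range (n + 1), e k
  have hx : ∀ n, x n ∈ stdSimplex ℝ S := by
    intro n
    have hn : (0 : ℝ) < (n : ℝ) + 1 := by positivity
    simp only [x, Finset.smul_sum]
    refine (convex_stdSimplex ℝ S).sum_mem (fun _ _ => by positivity) ?_ (fun k _ => he k)
    simp [hn.ne']
  have hdiff : ∀ n, f (x n) - x n = ((n : ℝ) + 1)⁻¹ • (e (n + 1) - e 0) := by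
    intro n
    have h1 : ∀ k, f (e k) = e (k + 1) := fun k => by simp [e, pow_succ']
    simp only [x, map_smul, map_sum, h1, ← smul_sub, ← Finset.sum_sub_distrib]
    rw [Finset.sum_range_sub]
  obtain ⟨μ, hμ, φ, hφ, hlim⟩ := (isCompact_stdSimplex ℝ S).tendsto_subseq hx
  have hfc : Continuous f := f.continuous_of_finiteDimensional
  have h1 : Tendsto (fun n => f (x (φ n)) - x (φ n)) atTop (𝓝 (f μ - μ)) :=
    ((hfc.tendsto μ).comp hlim).sub hlim
  have h2 : Tendsto (fun n => f (x n) - x n) atTop (𝓝 0) := by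
    simp only [hdiff]
    rw [tendsto_pi_nhds]
    intro j
    have hb : ∀ n, |(e (n + 1) - e 0) j| ≤ 1 := by
      intro n
      have a1 := (he (n + 1)).1 j
      have a2 := (he 0).1 j
      have a3 : e (n + 1) j ≤ 1 := (he (n + 1)).2 ▸
        Finset.single_le_sum (fun i _ => (he (n + 1)).1 i) (Finset.mem_univ j)
      have a4 : e 0 j ≤ 1 := (he 0).2 ▸
        Finset.single_le_sum (fun i _ => (he 0).1 i) (Finset.mem_univ j)
      rw [Pi.sub_apply, abs_le]
      constructor <;> linarith
    refine squeeze_zero_norm (a := fun n : ℕ => 1 / ((n : ℝ) + 1)) (fun n => ?_)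
      tendsto_one_div_add_atTop_nhds_zero_nat
    rw [Pi.smul_apply, smul_eq_mul, norm_mul, Real.norm_eq_abs, Real.norm_eq_abs,
      abs_of_nonneg (by positivity), one_div]
    exact mul_le_of_le_one_right (by positivity) (hb n)
  have h3 : f μ - μ = 0 := tendsto_nhds_unique h1 (h2.comp hφ.tendsto_atTop)
  exact ⟨μ, hμ, sub_eq_zero.1 h3⟩

/-- The invariant distribution of the chain induced by `π` (it is unique if the chain is
irreducible). -/
noncomputable def invariantDist (π : S → A) : S → ℝ := Classical.choose (M.exists_isInvariant π)

/-- The average reward `V(π) = ∑ i, μ(i) r_{π(i)}(i)` of the pure policy `π`. -/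
noncomputable def value (π : S → A) : ℝ := ∑ i, M.invariantDist π i * M.meanReward (π i) i

/-- The pure policy `π` is optimal. -/
def IsOptimal (π : S → A) : Prop := ∀ π' : S → A, M.value π' ≤ M.value π

/-- The optimal average reward: the largest average reward of a pure policy. -/
noncomputable def optimalValue : ℝ := ⨆ π : S → A, M.value π

end Pure

/-- The stages at the times `0, …, n`, as a tuple of length `n + 1`. -/
def toTuple {S A : Type*} (n : ℕ) (h : Finset.Iic n → Stage S A) : Fin (n + 1) → Stage S A :=
  fun k => h ⟨k, Finset.mem_Iic.2 (Nat.lt_succ_iff.1 k.2)⟩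

theorem measurable_toTuple {S A : Type*} [MeasurableSpace S] [MeasurableSpace A] {n : ℕ} :
    Measurable (toTuple (S := S) (A := A) n) :=
  measurable_pi_lambda _ fun _ => measurable_pi_apply _

section Dynamics

variable {S A : Type*} [Fintype S] [Fintype A] [MeasurableSpace S] [MeasurableSpace A]
  [DiscreteMeasurableSpace S] [DiscreteMeasurableSpace A] (M : MDP S A)

/-- The transition probabilities as a Markov kernel from pairs (state, action) to states. -/
noncomputable def transKernel : Kernel (S × A) S where
  toFun x := (M.trans x.2 x.1).toMeasure
  measurable' := Measurable.of_discrete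

instance : IsMarkovKernel M.transKernel := ⟨fun x => by
  change IsProbabilityMeasure (M.trans x.2 x.1).toMeasure; infer_instance⟩

/-- The payoff distributions as a Markov kernel from pairs (state, action) to `ℝ`. -/
noncomputable def payoffKernel : Kernel (S × A) ℝ where
  toFun x := M.payoff x.2 x.1
  measurable' := Measurable.of_discrete

instance : IsMarkovKernel M.payoffKernel := ⟨fun x => M.payoff_prob x.2 x.1⟩

/-- Given the past and the state at time `n`, the joint distribution of the state, the action
(drawn by the policy) and the payoff (drawn from the payoff distribution) at time `n`. -/
noncomputable def stageKernel (σ : Policy S A) (n : ℕ) :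
    Kernel ((Fin n → Stage S A) × S) (Stage S A) :=
  (Kernel.deterministic Prod.snd measurable_snd) ×ₖ
    (σ.choose n ⊗ₖ M.payoffKernel.comap
      (fun y : ((Fin n → Stage S A) × S) × A => (y.1.2, y.2)) (by fun_prop))

instance (σ : Policy S A) (n : ℕ) : IsMarkovKernel (M.stageKernel σ n) := by
  have := σ.markov n
  unfold stageKernel
  infer_instance

/-- The distribution of the stage at time `n + 1`, given the stages at the times `0, …, n`: the
state is drawn according to the transition probabilities, then action and payoff follow. -/
noncomputable def stepKernel (σ : Policy S A) (n : ℕ) :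
    Kernel (Finset.Iic n → Stage S A) (Stage S A) :=
  M.stageKernel σ (n + 1) ∘ₖ
    ((Kernel.deterministic (toTuple n) measurable_toTuple) ×ₖ
      M.transKernel.comap (fun h : Finset.Iic n → Stage S A =>
        ((h ⟨n, Finset.mem_Iic.2 le_rfl⟩).1, (h ⟨n, Finset.mem_Iic.2 le_rfl⟩).2.1)) (by fun_prop))

instance (σ : Policy S A) (n : ℕ) : IsMarkovKernel (M.stepKernel σ n) := by
  unfold stepKernel
  infer_instance

/-- The distribution of the stage at time `0`. -/
noncomputable def startMeasure (σ : Policy S A) : Measure (Stage S A) :=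
  M.stageKernel σ 0 ∘ₘ (M.init.toMeasure.map fun i => (Fin.elim0, i))

instance (σ : Policy S A) : IsProbabilityMeasure (M.startMeasure σ) := by
  have : IsProbabilityMeasure
      (M.init.toMeasure.map fun i => ((Fin.elim0, i) : (Fin 0 → Stage S A) × S)) :=
    Measure.isProbabilityMeasure_map (Measurable.aemeasurable (by fun_prop))
  unfold startMeasure
  infer_instance

/-- The law of the process (states, actions and payoffs at all times) under the policy `σ`, given
by the theorem of Ionescu-Tulcea. -/
noncomputable def law (σ : Policy S A) : Measure (ℕ → Stage S A) :=
  Kernel.trajMeasure (X := fun _ => Stage S A) (M.startMeasure σ) (M.stepKernel σ)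

/-- The expectation of the average `(1 / n) ∑_{t < n} R_t` of the first `n` payoffs. -/
noncomputable def expectedAverage (σ : Policy S A) (n : ℕ) : ℝ :=
  ∫ ω, (∑ t ∈ Finset.range n, (ω t).2.2) / n ∂(M.law σ)

/-- The average of the mean rewards of the first `n` stages of a trajectory `ω`, which is
`∑ i, μ_n(i) ∑ a, λ_i^n(a) r_a(i)` for the relative frequencies `μ_n(i)` of the visits to `i` and
`λ_i^n(a)` of the choice of `a` at these visits. -/
noncomputable def pathAverage (ω : ℕ → Stage S A) (n : ℕ) : ℝ :=
  (∑ t ∈ Finset.range n, M.meanReward (ω t).2.1 (ω t).1) / n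

/-- The policy `σ` attains the average reward `v`: every payoff is integrable, and the expected
average of the first `n` payoffs tends to `v`. -/
def HasAverageReward (σ : Policy S A) (v : ℝ) : Prop :=
  (∀ t : ℕ, Integrable (fun ω : ℕ → Stage S A => (ω t).2.2) (M.law σ)) ∧
    Tendsto (M.expectedAverage σ) atTop (𝓝 v)

/-- The general policy `σ` is optimal: its average reward exists and is the largest average
reward of a pure policy, and no general policy does better in the long run. -/
def IsOptimalPolicy (σ : Policy S A) : Prop :=
  M.HasAverageReward σ M.optimalValue ∧
    ∀ σ' : Policy S A, ∀ ε > 0, ∀ᶠ n in atTop, M.expectedAverage σ' n < M.optimalValue + ε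

end Dynamics

end MDP

/-! A single function `h` serves all optimal pure policies at once. Let `g` be the optimal value and
`h` a solution of the Poisson equation of one optimal pure policy (`exists_defect_eq_zero`). For
every pure policy, its invariant distribution averages the defect to its value minus `g`
(`sum_invariantDist_mul_defect`), and by irreducibility it charges every state. Hence no defect is
positive, as switching the action at one state would otherwise beat the optimum; and the defect
vanishes along every optimal policy, being nonpositive with weighted sum zero
(`exists_defect_nonpos`). A mixture of optimal policies therefore only ever takes actions of zero
defect, however erratically it chooses among them.

By `meanReward_sub_eq`, the mean reward minus `g` is the defect, plus a martingale difference, plus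
a term that telescopes to something bounded. In expectation the martingale difference vanishes, so
the average payoff tends to `g` when the defects are zero, and eventually stays below `g + ε` for
any policy, since defects are nonpositive. Almost surely, the averaged martingale differences vanish
by a strong law for bounded orthogonal variables (`ae_tendsto_sum_div_of_orthogonal`). -/

theorem Matrix.IsIrreducible.mem_of_closed {n : Type*} {P : Matrix n n ℝ} (hP : P.IsIrreducible)
    {T : Set n} (hT : ∀ i ∈ T, ∀ j, 0 < P i j → j ∈ T) {i : n} (hi : i ∈ T) (j : n) : j ∈ T := by
  let : Quiver n := P.toQuiver
  obtain ⟨p, -⟩ := hP.connected i j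
  induction p with
  | nil => exact hi
  | cons q e ih => exact hT _ ih _ e.down

/-! ### The Poisson equation and the optimality equation -/

namespace MDP

section Bellman

variable {S A : Type*} (M : MDP S A)

theorem prob_nonneg (a : A) (i j : S) : 0 ≤ M.prob a i j := ENNReal.toReal_nonneg

variable [Fintype S]

/-- The defect `r_a(i) + ∑ j, p_a(i, j) h(j) - g - h(i)` of the pair `(g, h)` in the optimality
equation of average reward. -/
noncomputable def defect (g : ℝ) (h : S → ℝ) (a : A) (i : S) : ℝ :=
  M.meanReward a i + ∑ j, M.prob a i j * h j - g - h i

theorem invariantDist_nonneg (π : S → A) (i : S) : 0 ≤ M.invariantDist π i :=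
  (Classical.choose_spec (M.exists_isInvariant π)).1.1 i

theorem sum_invariantDist (π : S → A) : ∑ i, M.invariantDist π i = 1 :=
  (Classical.choose_spec (M.exists_isInvariant π)).1.2

theorem sum_invariantDist_mul_prob (π : S → A) (j : S) :
    ∑ i, M.invariantDist π i * M.prob (π i) i j = M.invariantDist π j :=
  congrFun (Classical.choose_spec (M.exists_isInvariant π)).2 j

/-- Total mass 1 makes the support nonempty, and invariance makes it closed under transitions of
positive probability. -/
theorem invariantDist_pos (π : S → A) (hπ : (M.matrix π).IsIrreducible) (i : S) :
    0 < M.invariantDist π i := by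
  obtain ⟨k, -, hk⟩ : ∃ k ∈ Finset.univ, 0 < M.invariantDist π k := by
    refine Finset.exists_lt_of_sum_lt ?_
    simp [sum_invariantDist]
  refine hπ.mem_of_closed (T := {i | 0 < M.invariantDist π i}) (fun i hi j hij => ?_) hk i
  rw [Set.mem_ofPred_eq, ← sum_invariantDist_mul_prob]
  exact Finset.sum_pos' (fun l _ => mul_nonneg (M.invariantDist_nonneg π l) (M.prob_nonneg _ _ _))
    ⟨i, Finset.mem_univ i, mul_pos hi hij⟩

theorem sum_invariantDist_mul_sum_prob (π : S → A) (h : S → ℝ) :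
    ∑ i, M.invariantDist π i * ∑ j, M.prob (π i) i j * h j = ∑ i, M.invariantDist π i * h i := by
  simp only [Finset.mul_sum]
  rw [Finset.sum_comm]
  simp only [← mul_assoc, ← Finset.sum_mul, sum_invariantDist_mul_prob]

/-- Invariance cancels both terms in `h`. As `h` need not belong to `π`, this compares different
policies through one `h`. -/
theorem sum_invariantDist_mul_defect (π : S → A) (g : ℝ) (h : S → ℝ) :
    ∑ i, M.invariantDist π i * M.defect g h (π i) i = M.value π - g := by
  simp only [defect, mul_sub, mul_add, Finset.sum_sub_distrib, Finset.sum_add_distrib,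
    sum_invariantDist_mul_sum_prob, ← Finset.sum_mul, sum_invariantDist, value]
  ring

/-- Functions that are harmonic for an irreducible chain are constant. -/
theorem eq_of_harmonic (π : S → A) (hπ : (M.matrix π).IsIrreducible) {h : S → ℝ}
    (hh : ∀ i, ∑ j, M.prob (π i) i j * h j = h i) (i j : S) : h i = h j := by
  have : Nonempty S := ⟨i⟩
  obtain ⟨m, hm⟩ := Finite.exists_max h
  suffices ∀ k, h k = h m by rw [this i, this j]
  -- Maximum principle: at a maximum point the weighted mean of the nonnegative gaps `h m - h j` is
  -- zero, so every reachable `j` is a maximum point too.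
  refine hπ.mem_of_closed (T := {k | h k = h m}) (fun k hk l hl => ?_) rfl
  rw [Set.mem_ofPred_eq] at hk ⊢
  have h0 : ∑ j, M.prob (π k) k j * (h m - h j) = 0 := by
    simp only [mul_sub, Finset.sum_sub_distrib, ← Finset.sum_mul, sum_prob, hh, hk]
    ring
  have h1 := (Finset.sum_eq_zero_iff_of_nonneg fun j _ =>
    mul_nonneg (M.prob_nonneg (π k) k j) (sub_nonneg.2 (hm j))).1 h0 l (Finset.mem_univ l)
  rcases mul_eq_zero.1 h1 with h2 | h2
  · exact absurd h2 (ne_of_gt hl)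
  · linarith

/-- The Poisson equation of an irreducible pure policy. -/
theorem exists_defect_eq_zero (π : S → A) (hπ : (M.matrix π).IsIrreducible) :
    ∃ h : S → ℝ, ∀ i, M.defect (M.value π) h (π i) i = 0 := by
  obtain ⟨s, -⟩ := M.init.support_nonempty
  -- Fredholm alternative by counting dimensions: `L` kills only constants, so its range has
  -- codimension at most 1, while it lies in the hyperplane `ker ℓ`. The two coincide, and the value
  -- is exactly the constant that puts the right-hand side into this hyperplane.
  let L : (S → ℝ) →ₗ[ℝ] (S → ℝ) := Matrix.mulVecLin (M.matrix π) - LinearMap.id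
  let ℓ : (S → ℝ) →ₗ[ℝ] ℝ := ∑ i, M.invariantDist π i • LinearMap.proj i
  have hL : ∀ h i, L h i = ∑ j, M.prob (π i) i j * h j - h i := fun h i => rfl
  have hℓ : ∀ h, ℓ h = ∑ i, M.invariantDist π i * h i := fun h => by simp [ℓ]
  have hker : LinearMap.ker L ≤ Submodule.span ℝ {fun _ => (1 : ℝ)} := by
    intro h hh
    have hh' : ∀ i, ∑ j, M.prob (π i) i j * h j = h i := fun i => by
      have := congrFun (LinearMap.mem_ker.1 hh) i
      rw [hL, Pi.zero_apply] at this
      linarith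
    rw [Submodule.mem_span_singleton]
    exact ⟨h s, by ext i; simp [M.eq_of_harmonic π hπ hh' s i]⟩
  have hker1 : Module.finrank ℝ (LinearMap.ker L) ≤ 1 :=
    (Submodule.finrank_mono hker).trans ((finrank_span_le_card _).trans (by simp))
  have hrange : LinearMap.range L ≤ LinearMap.ker ℓ := by
    rintro _ ⟨h, rfl⟩
    rw [LinearMap.mem_ker, hℓ]
    simp only [hL, mul_sub, Finset.sum_sub_distrib, sum_invariantDist_mul_sum_prob, sub_self]
  have hsurj : LinearMap.range ℓ = ⊤ := by
    refine LinearMap.range_eq_top.2 fun x => ⟨fun _ => x, ?_⟩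
    rw [hℓ, ← Finset.sum_mul, sum_invariantDist, one_mul]
  have e1 := L.finrank_range_add_finrank_ker
  have e2 := ℓ.finrank_range_add_finrank_ker
  rw [hsurj, finrank_top, Module.finrank_self] at e2
  have heq : LinearMap.range L = LinearMap.ker ℓ :=
    Submodule.eq_of_le_of_finrank_le hrange (by omega)
  have hmem : (fun i => M.value π - M.meanReward (π i) i) ∈ LinearMap.range L := by
    rw [heq, LinearMap.mem_ker, hℓ]
    simp only [mul_sub, Finset.sum_sub_distrib, ← Finset.sum_mul, sum_invariantDist, value]
    ring
  obtain ⟨h, hh⟩ := hmem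
  refine ⟨h, fun i => ?_⟩
  have := congrFun hh i
  rw [hL] at this
  simp only [defect]
  linarith

theorem IsOptimal.value_eq {M : MDP S A} {π : S → A} (hπ : M.IsOptimal π) :
    M.value π = M.optimalValue :=
  have : Nonempty (S → A) := ⟨π⟩
  le_antisymm (le_ciSup (f := M.value) ⟨M.value π, by rintro _ ⟨π', rfl⟩; exact hπ π'⟩ π)
    (ciSup_le hπ)

/-- In a unichain process, the bias of an optimal pure policy solves the optimality equation
(policy improvement). -/
theorem exists_defect_nonpos [Finite A] [Nonempty A] (hM : M.IsUnichain) :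
    ∃ h : S → ℝ, (∀ a i, M.defect M.optimalValue h a i ≤ 0) ∧
      ∀ π, M.IsOptimal π → ∀ i, M.defect M.optimalValue h (π i) i = 0 := by
  classical
  obtain ⟨π, hπ⟩ : ∃ π, M.IsOptimal π := Finite.exists_max M.value
  obtain ⟨h, hh⟩ := M.exists_defect_eq_zero π (hM π)
  rw [hπ.value_eq] at hh
  have hle : ∀ a i, M.defect M.optimalValue h a i ≤ 0 := by
    intro a i
    by_contra! hpos
    -- Away from `i` the updated policy agrees with `π` and has zero defect, so its gain over the
    -- optimum is the single positive term at `i`.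
    have h1 := M.sum_invariantDist_mul_defect (Function.update π i a) M.optimalValue h
    have h2 : M.value (Function.update π i a) ≤ M.optimalValue := hπ.value_eq ▸ hπ _
    rw [Finset.sum_eq_single i] at h1
    · rw [Function.update_self] at h1
      have := mul_pos (M.invariantDist_pos _ (hM (Function.update π i a)) i) hpos
      linarith
    · intro j _ hj
      rw [Function.update_of_ne hj, hh, mul_zero]
    · simp
  refine ⟨h, hle, fun π' hπ' i => ?_⟩
  have h1 := M.sum_invariantDist_mul_defect π' M.optimalValue h
  rw [hπ'.value_eq, sub_self] at h1
  have h2 := (Finset.sum_eq_zero_iff_of_nonpos fun j _ =>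
    mul_nonpos_of_nonneg_of_nonpos (M.invariantDist_nonneg π' j) (hle (π' j) j)).1 h1 i
    (Finset.mem_univ i)
  exact (mul_eq_zero.1 h2).resolve_left (M.invariantDist_pos π' (hM π') i).ne'

/-- The deviation of `h` at the state of the next stage `y` from its conditional expectation given
the present stage `x`. -/
noncomputable def transError (h : S → ℝ) (x y : Stage S A) : ℝ :=
  h y.1 - ∑ j, M.prob x.2.1 x.1 j * h j

/-- The error involves two states and an action, hence takes finitely many values; the possibly
unbounded payoffs do not enter. -/
theorem exists_abs_transError_le [Fintype A] (h : S → ℝ) :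
    ∃ C, ∀ x y, |M.transError h x y| ≤ C := by
  let f : S × A × S → ℝ := fun p => |h p.2.2 - ∑ j, M.prob p.2.1 p.1 j * h j|
  exact ⟨∑ p, f p, fun x y => Finset.single_le_sum (f := f) (fun _ _ => abs_nonneg _)
    (Finset.mem_univ (x.1, x.2.1, y.1))⟩

theorem meanReward_sub_eq (g : ℝ) (h : S → ℝ) (x y : Stage S A) :
    M.meanReward x.2.1 x.1 - g =
      M.defect g h x.2.1 x.1 + M.transError h x y + (h x.1 - h y.1) := by
  simp only [defect, transError]; ring

end Bellman

end MDP

/-! ### A strong law for bounded orthogonal variables -/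

section StrongLaw

variable {Ω : Type*} {mΩ : MeasurableSpace Ω} {μ : Measure Ω} [IsProbabilityMeasure μ]
  {D : ℕ → Ω → ℝ} {C : ℝ}

theorem integral_sq_sum_le_of_orthogonal (hD : ∀ t, Measurable (D t)) (hC : ∀ t ω, |D t ω| ≤ C)
    (horth : ∀ s t, s < t → ∫ ω, D s ω * D t ω ∂μ = 0) (n : ℕ) :
    ∫ ω, (∑ t ∈ Finset.range n, D t ω) ^ 2 ∂μ ≤ n * C ^ 2 := by
  have hmul : ∀ s t, Integrable (fun ω => D s ω * D t ω) μ := fun s t =>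
    Integrable.of_bound ((hD s).mul (hD t)).aestronglyMeasurable (C * C)
      (Eventually.of_forall fun ω => by
        rw [norm_mul]
        exact mul_le_mul (hC s ω) (hC t ω) (norm_nonneg _) ((abs_nonneg _).trans (hC s ω)))
  induction n with
  | zero => simp
  | succ n ih =>
    have h1 : ∀ ω, (∑ t ∈ Finset.range (n + 1), D t ω) ^ 2 =
        (∑ t ∈ Finset.range n, D t ω) ^ 2 +
          (2 * ∑ s ∈ Finset.range n, D s ω * D n ω + D n ω * D n ω) := fun ω => by
      rw [Finset.sum_range_succ, ← Finset.sum_mul]; ring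
    have i1 : Integrable (fun ω => (∑ t ∈ Finset.range n, D t ω) ^ 2) μ := by
      simp_rw [sq, Finset.sum_mul_sum]
      exact integrable_finsetSum _ fun s _ => integrable_finsetSum _ fun t _ => hmul s t
    have i2 : Integrable (fun ω => 2 * ∑ s ∈ Finset.range n, D s ω * D n ω) μ :=
      (integrable_finsetSum _ fun s _ => hmul s n).const_mul 2
    have h2 : ∫ ω, D n ω * D n ω ∂μ ≤ C ^ 2 := by
      have := integral_mono (hmul n n) (integrable_const (μ := μ) (C ^ 2)) fun ω => by
        have := sq_le_sq' (neg_le_of_abs_le (hC n ω)) (le_of_abs_le (hC n ω))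
        simpa [sq] using this
      simpa using this
    have h3 : ∫ ω, ∑ s ∈ Finset.range n, D s ω * D n ω ∂μ = 0 := by
      rw [integral_finsetSum _ fun s _ => hmul s n]
      exact Finset.sum_eq_zero fun s hs => horth s n (Finset.mem_range.1 hs)
    simp_rw [h1]
    have h4 : ∫ ω, ((∑ t ∈ Finset.range n, D t ω) ^ 2 +
        (2 * ∑ s ∈ Finset.range n, D s ω * D n ω + D n ω * D n ω)) ∂μ = _ :=
      integral_add i1 (i2.add (hmul n n))
    have h5 : ∫ ω, (2 * ∑ s ∈ Finset.range n, D s ω * D n ω + D n ω * D n ω) ∂μ = _ :=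
      integral_add i2 (hmul n n)
    rw [integral_const_mul, h3] at h5
    rw [h4, h5]
    push_cast
    linarith

theorem abs_sum_range_sub_le (hC : ∀ t ω, |D t ω| ≤ C) (ω : Ω) {m n : ℕ} (hmn : m ≤ n) :
    |∑ t ∈ Finset.range n, D t ω - ∑ t ∈ Finset.range m, D t ω| ≤ (n - m : ℕ) * C := by
  rw [← Finset.sum_Ico_eq_sub _ hmn]
  refine (Finset.abs_sum_le_sum_abs _ _).trans ((Finset.sum_le_sum fun t _ => hC t ω).trans ?_)
  simp

/-- Between consecutive squares there are at most `2 * k` further terms, which change the sum by at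
most `2 * k * C`, negligible against `k ^ 2`. -/
theorem tendsto_sum_div_of_tendsto_sq (hC : ∀ t ω, |D t ω| ≤ C) (ω : Ω)
    (h : Tendsto (fun k : ℕ => (∑ t ∈ Finset.range (k ^ 2), D t ω) / (k : ℝ) ^ 2) atTop (𝓝 0)) :
    Tendsto (fun n : ℕ => (∑ t ∈ Finset.range n, D t ω) / (n : ℝ)) atTop (𝓝 0) := by
  have hC0 : 0 ≤ C := (abs_nonneg _).trans (hC 0 ω)
  have hsqrt : Tendsto Nat.sqrt atTop atTop :=
    tendsto_atTop_mono' _ (Eventually.of_forall fun n => le_rfl)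
      (tendsto_atTop_atTop.2 fun b => ⟨b * b, fun a ha => Nat.le_sqrt.2 ha⟩)
  have h1 : Tendsto (fun k : ℕ => |(∑ t ∈ Finset.range (k ^ 2), D t ω) / (k : ℝ) ^ 2| +
      2 * C / (k : ℝ)) atTop (𝓝 0) := by
    have := h.abs.add (tendsto_const_div_atTop_nhds_zero_nat (2 * C))
    simpa using this
  refine squeeze_zero_norm' ?_ (h1.comp hsqrt)
  filter_upwards [eventually_ge_atTop 1] with n hn
  set k := n.sqrt with hk
  have hk1 : k ^ 2 ≤ n := Nat.sqrt_le' n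
  have hk2 : n - k ^ 2 ≤ 2 * k := by
    have := Nat.sqrt_le_add n
    rw [← hk] at this
    rw [sq]; omega
  have hk0 : 0 < (k : ℝ) := by exact_mod_cast Nat.sqrt_pos.2 hn
  have hn0 : 0 < (n : ℝ) := by exact_mod_cast hn
  have hkn : (k : ℝ) ^ 2 ≤ n := by exact_mod_cast hk1
  have hd := abs_sum_range_sub_le hC ω hk1
  have hd' : ((n - k ^ 2 : ℕ) : ℝ) * C ≤ 2 * k * C :=
    mul_le_mul_of_nonneg_right (by exact_mod_cast hk2) hC0
  have h3 : |∑ t ∈ Finset.range n, D t ω| ≤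
      |∑ t ∈ Finset.range (k ^ 2), D t ω| + 2 * k * C := by
    have := abs_sub_abs_le_abs_sub (∑ t ∈ Finset.range n, D t ω)
      (∑ t ∈ Finset.range (k ^ 2), D t ω)
    linarith
  rw [Function.comp_apply, Real.norm_eq_abs, abs_div, abs_div, abs_of_pos hn0,
    abs_of_pos (pow_pos hk0 2)]
  calc |∑ t ∈ Finset.range n, D t ω| / n
      ≤ (|∑ t ∈ Finset.range (k ^ 2), D t ω| + 2 * k * C) / (k : ℝ) ^ 2 :=
        div_le_div₀ (by positivity) h3 (by positivity) hkn
    _ = |∑ t ∈ Finset.range (k ^ 2), D t ω| / (k : ℝ) ^ 2 + 2 * C / k := by field_simp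

/-- The strong law of large numbers for bounded orthogonal random variables. -/
theorem ae_tendsto_sum_div_of_orthogonal (hD : ∀ t, Measurable (D t)) (hC : ∀ t ω, |D t ω| ≤ C)
    (horth : ∀ s t, s < t → ∫ ω, D s ω * D t ω ∂μ = 0) :
    ∀ᵐ ω ∂μ, Tendsto (fun n : ℕ => (∑ t ∈ Finset.range n, D t ω) / (n : ℝ)) atTop (𝓝 0) := by
  -- Along the squares the second moments are at most `C ^ 2 / k ^ 2`, which is summable. So the sum
  -- of the `Z k` is almost surely finite and its terms tend to zero.
  let Z : ℕ → Ω → ℝ := fun k ω => ((∑ t ∈ Finset.range (k ^ 2), D t ω) / (k : ℝ) ^ 2) ^ 2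
  have hZm : ∀ k, Measurable (Z k) := fun k => by fun_prop
  have hZ0 : ∀ k ω, 0 ≤ Z k ω := fun k ω => sq_nonneg _
  have hZi : ∀ k, Integrable (Z k) μ := fun k => by
    refine Integrable.of_bound (hZm k).aestronglyMeasurable
      ((((k ^ 2 : ℕ) : ℝ) * C / (k : ℝ) ^ 2) ^ 2) (Eventually.of_forall fun ω => ?_)
    have := abs_sum_range_sub_le hC ω (Nat.zero_le (k ^ 2))
    simp only [Finset.range_zero, Finset.sum_empty, sub_zero, Nat.sub_zero] at this
    rw [norm_pow, Real.norm_eq_abs, abs_div, abs_of_nonneg (sq_nonneg (k : ℝ))]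
    gcongr
  have hZle : ∀ k : ℕ, ∫ ω, Z k ω ∂μ ≤ C ^ 2 * (1 / (k : ℝ) ^ 2) := fun k => by
    simp only [Z, div_pow, integral_div]
    rcases Nat.eq_zero_or_pos k with rfl | hk
    · simp
    have hk0 : 0 < (k : ℝ) := by exact_mod_cast hk
    have := integral_sq_sum_le_of_orthogonal hD hC horth (k ^ 2)
    rw [div_le_iff₀ (by positivity)]
    refine this.trans_eq ?_
    push_cast
    field_simp
  have hsum : Summable fun k => ∫ ω, Z k ω ∂μ :=
    Summable.of_nonneg_of_le (fun k => integral_nonneg (hZ0 k)) hZle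
      ((Real.summable_one_div_nat_pow.2 one_lt_two).mul_left _)
  have hfin : ∫⁻ ω, ∑' k, ENNReal.ofReal (Z k ω) ∂μ ≠ ⊤ := by
    rw [lintegral_tsum fun k => (hZm k).ennreal_ofReal.aemeasurable]
    simp_rw [← ofReal_integral_eq_lintegral_ofReal (hZi _) (Eventually.of_forall (hZ0 _))]
    exact hsum.tsum_ofReal_ne_top
  have hae := ae_lt_top (Measurable.tsum fun k => (hZm k).ennreal_ofReal) hfin
  filter_upwards [hae] with ω hω
  refine tendsto_sum_div_of_tendsto_sq hC ω ?_
  have h1 := ENNReal.tendsto_atTop_zero_of_tsum_ne_top hω.ne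
  have h2 : Tendsto (fun k => Z k ω) atTop (𝓝 0) := by
    have := (ENNReal.tendsto_toReal ENNReal.zero_ne_top).comp h1
    simpa [Function.comp_def, ENNReal.toReal_ofReal (hZ0 _ _)] using this
  have h3 := h2.sqrt
  simp only [Z, Real.sqrt_sq_eq_abs, Real.sqrt_zero] at h3
  exact (tendsto_zero_iff_abs_tendsto_zero _).2 h3

theorem tendsto_sub_div_of_bounded {u : ℕ → ℝ} {K : ℝ} (hu : ∀ n, |u n| ≤ K) :
    Tendsto (fun n : ℕ => (u 0 - u n) / (n : ℝ)) atTop (𝓝 0) := by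
  refine squeeze_zero_norm (fun n => ?_) (tendsto_const_div_atTop_nhds_zero_nat (K + K))
  rw [norm_div, Real.norm_natCast]
  gcongr
  exact (abs_sub _ _).trans (add_le_add (hu 0) (hu n))

theorem exists_abs_le {S : Type*} [Fintype S] (h : S → ℝ) : ∃ K, ∀ i, |h i| ≤ K :=
  ⟨∑ i, |h i|, fun i => Finset.single_le_sum (f := fun i => |h i|) (fun _ _ => abs_nonneg _)
    (Finset.mem_univ i)⟩

end StrongLaw

/-! ### The law of the process and its conditional expectations -/

namespace MDP

section Law

variable {S A : Type*} [Fintype S] [Fintype A] [MeasurableSpace S] [MeasurableSpace A]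
  [DiscreteMeasurableSpace S] [DiscreteMeasurableSpace A] (M : MDP S A)

instance (σ : Policy S A) : IsProbabilityMeasure (M.law σ) := by
  unfold law; infer_instance

theorem lintegral_stageKernel (σ : Policy S A) (n : ℕ) (x : (Fin n → Stage S A) × S)
    {f : Stage S A → ENNReal} (hf : Measurable f) :
    ∫⁻ y, f y ∂(M.stageKernel σ n x) =
      ∫⁻ a, ∫⁻ r, f (x.2, a, r) ∂(M.payoff a x.2) ∂(σ.choose n x) := by
  have := σ.markov n
  rw [stageKernel, Kernel.lintegral_deterministic_prod _ _ _ hf,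
    Kernel.lintegral_compProd _ _ _ (by fun_prop)]
  rfl

theorem ae_stageKernel_iff (σ : Policy S A) (n : ℕ) (x : (Fin n → Stage S A) × S)
    {p : Stage S A → Prop} (hp : MeasurableSet {y | p y}) :
    (∀ᵐ y ∂(M.stageKernel σ n x), p y) ↔
      ∀ᵐ a ∂(σ.choose n x), ∀ᵐ r ∂(M.payoff a x.2), p (x.2, a, r) := by
  have hm : Measurable (Set.indicator {y | p y}ᶜ (1 : Stage S A → ENNReal)) :=
    measurable_one.indicator hp.compl
  have key : M.stageKernel σ n x {y | p y}ᶜ =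
      ∫⁻ a, M.payoff a x.2 {r | p (x.2, a, r)}ᶜ ∂(σ.choose n x) := by
    rw [← lintegral_indicator_one hp.compl, lintegral_stageKernel M σ n x hm]
    refine lintegral_congr fun a => ?_
    rw [← lintegral_indicator_one]
    · rfl
    · exact (measurable_prodMk_left.comp measurable_prodMk_left : Measurable
        fun r : ℝ => (x.2, a, r)) hp.compl
  rw [ae_iff, ← Set.compl_ofPred, key, lintegral_eq_zero_iff Measurable.of_discrete]
  rfl

/-- Finitely many payoff distributions allow a bound uniform in policy, time and past, which
survives averaging over the past. -/
theorem exists_lintegral_enorm_stageKernel_le :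
    ∃ K : ENNReal, K ≠ ⊤ ∧ ∀ (σ : Policy S A) n x, ∫⁻ y, ‖y.2.2‖ₑ ∂(M.stageKernel σ n x) ≤ K := by
  refine ⟨∑ p : A × S, ∫⁻ r, ‖r‖ₑ ∂(M.payoff p.1 p.2), ?_, fun σ n x => ?_⟩
  · exact (ENNReal.sum_lt_top.2 fun p _ => (M.payoff_integrable p.1 p.2).2).ne
  · have := σ.markov n
    rw [lintegral_stageKernel M σ n x (by fun_prop)]
    refine (lintegral_mono fun a => Finset.single_le_sum
      (f := fun p : A × S => ∫⁻ r, ‖r‖ₑ ∂(M.payoff p.1 p.2)) (fun _ _ => zero_le)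
      (Finset.mem_univ (a, x.2))).trans ?_
    simp

theorem integrable_payoff_stageKernel (σ : Policy S A) (n : ℕ) (x : (Fin n → Stage S A) × S) :
    Integrable (fun y : Stage S A => y.2.2) (M.stageKernel σ n x) := by
  obtain ⟨K, hK, h⟩ := M.exists_lintegral_enorm_stageKernel_le
  exact ⟨measurable_snd.snd.aestronglyMeasurable, (h σ n x).trans_lt hK.lt_top⟩

/-- A function of the state and the action is integrable under every probability measure. -/
theorem integrable_comp_state_action {Ω : Type*} {mΩ : MeasurableSpace Ω} (μ : Measure Ω)
    [IsFiniteMeasure μ] {X : Ω → S × A} (hX : Measurable X) (f : S × A → ℝ) :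
    Integrable (fun ω => f (X ω)) μ :=
  Integrable.comp_measurable (f := X) (g := f) Integrable.of_finite hX

theorem integral_payoff_sub_meanReward_stageKernel (σ : Policy S A) (n : ℕ)
    (x : (Fin n → Stage S A) × S) :
    ∫ y, (y.2.2 - M.meanReward y.2.1 y.1) ∂(M.stageKernel σ n x) = 0 := by
  have := σ.markov n
  have hint : Integrable (fun y : Stage S A => y.2.2 - M.meanReward y.2.1 y.1)
      (M.stageKernel σ n x) :=
    (M.integrable_payoff_stageKernel σ n x).sub
      (integrable_comp_state_action (M.stageKernel σ n x) (X := fun y => (y.1, y.2.1))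
        (by fun_prop) fun p => M.meanReward p.2 p.1)
  -- With the state fixed, the stage is the random pair of action and payoff with that state
  -- attached; the integral can then be iterated, payoff innermost.
  have hmap : M.stageKernel σ n x = ((σ.choose n ⊗ₖ M.payoffKernel.comap
      (fun y : ((Fin n → Stage S A) × S) × A => (y.1.2, y.2)) (by fun_prop)) x).map
        (Prod.mk x.2) := by
    rw [stageKernel, Kernel.prod_apply, Kernel.deterministic_apply, Measure.dirac_prod]
  rw [hmap] at hint ⊢
  rw [integral_map (by fun_prop) hint.1]
  rw [integrable_map_measure hint.1 (by fun_prop)] at hint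
  rw [Function.comp_def] at hint
  rw [integral_compProd hint]
  refine integral_eq_zero_of_ae (Eventually.of_forall fun a => ?_)
  have := M.payoff_prob a x.2
  change ∫ r, (r - M.meanReward a x.2) ∂(M.payoff a x.2) = 0
  rw [integral_sub (M.payoff_integrable a x.2) (integrable_const _)]
  simp [meanReward]

theorem map_frestrictLe_law_compProd (σ : Policy S A) (n : ℕ) :
    (M.law σ).map (Preorder.frestrictLe n) ⊗ₘ M.stepKernel σ n =
      (M.law σ).map (fun ω => (Preorder.frestrictLe n ω, ω (n + 1))) :=
  Kernel.map_frestrictLe_trajMeasure_compProd_eq_map_trajMeasure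

theorem map_eval_zero_law (σ : Policy S A) :
    (M.law σ).map (fun ω => ω 0) = M.startMeasure σ := by
  have h0 : (fun ω : ℕ → Stage S A => ω 0) =
      (fun x : Finset.Iic 0 → Stage S A => x ⟨0, Finset.mem_Iic.2 le_rfl⟩) ∘
        Preorder.frestrictLe (π := fun _ => Stage S A) 0 := rfl
  rw [h0, ← Measure.map_map (by fun_prop) (by fun_prop), law, Kernel.trajMeasure,
    Measure.map_comp _ _ (by fun_prop), Kernel.traj_map_frestrictLe, Kernel.partialTraj_self,
    Measure.id_comp, Measure.map_map (by fun_prop) (by fun_prop)]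
  exact Measure.map_id

/-- At each time, the stage is drawn from the stage kernel. -/
theorem exists_map_eval_law (σ : Policy S A) (n : ℕ) :
    ∃ ν : Measure ((Fin n → Stage S A) × S), IsProbabilityMeasure ν ∧
      (M.law σ).map (fun ω => ω n) = M.stageKernel σ n ∘ₘ ν := by
  -- In both cases `ν` is the joint law of the past and the present state; at time 0 the past is the
  -- empty tuple.
  cases n with
  | zero =>
    refine ⟨_, ?_, M.map_eval_zero_law σ⟩
    exact Measure.isProbabilityMeasure_map (Measurable.aemeasurable (by fun_prop))
  | succ n =>
    have h1 : (M.law σ).map (fun ω => ω (n + 1)) =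
        M.stepKernel σ n ∘ₘ (M.law σ).map (Preorder.frestrictLe n) := by
      rw [← Measure.snd_compProd, map_frestrictLe_law_compProd, Measure.snd,
        Measure.map_map measurable_snd (by fun_prop)]
      rfl
    rw [h1, stepKernel, ← Measure.comp_assoc]
    have : IsProbabilityMeasure
        ((M.law σ).map (Preorder.frestrictLe (π := fun _ => Stage S A) n)) :=
      Measure.isProbabilityMeasure_map (Measurable.aemeasurable (by fun_prop))
    exact ⟨_, inferInstance, rfl⟩

theorem integrable_payoff_law (σ : Policy S A) (n : ℕ) :
    Integrable (fun ω : ℕ → Stage S A => (ω n).2.2) (M.law σ) := by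
  obtain ⟨ν, hν, h⟩ := M.exists_map_eval_law σ n
  obtain ⟨K, hK, hle⟩ := M.exists_lintegral_enorm_stageKernel_le
  have : Integrable (fun y : Stage S A => y.2.2) ((M.law σ).map (fun ω => ω n)) := by
    rw [h]
    refine ⟨measurable_snd.snd.aestronglyMeasurable, ?_⟩
    rw [HasFiniteIntegral, Measure.lintegral_bind (Kernel.aemeasurable _) (by fun_prop)]
    exact (lintegral_mono fun x => hle σ n x).trans_lt (by simpa using hK.lt_top)
  exact this.comp_measurable (by fun_prop)

theorem integral_payoff_law (σ : Policy S A) (n : ℕ) :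
    ∫ ω, (ω n).2.2 ∂(M.law σ) = ∫ ω, M.meanReward (ω n).2.1 (ω n).1 ∂(M.law σ) := by
  obtain ⟨ν, hν, h⟩ := M.exists_map_eval_law σ n
  have i1 := M.integrable_payoff_law σ n
  have i2 : Integrable (fun ω : ℕ → Stage S A => M.meanReward (ω n).2.1 (ω n).1) (M.law σ) :=
    integrable_comp_state_action _ (X := fun ω : ℕ → Stage S A => ((ω n).1, (ω n).2.1))
      (by fun_prop) fun p => M.meanReward p.2 p.1
  have hm : Measurable fun y : Stage S A => y.2.2 - M.meanReward y.2.1 y.1 := by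
    have : Measurable fun p : S × A => M.meanReward p.2 p.1 := Measurable.of_discrete
    exact measurable_snd.snd.sub (this.comp (f := fun y : Stage S A => (y.1, y.2.1))
      (by fun_prop))
  rw [← sub_eq_zero, ← integral_sub i1 i2]
  have h1 : ∫ y, (y.2.2 - M.meanReward y.2.1 y.1) ∂((M.law σ).map (fun ω => ω n)) =
      ∫ ω, ((ω n).2.2 - M.meanReward (ω n).2.1 (ω n).1) ∂(M.law σ) :=
    integral_map (Measurable.aemeasurable (by fun_prop)) hm.aestronglyMeasurable
  rw [← h1]
  have i3 : Integrable (fun y : Stage S A => y.2.2 - M.meanReward y.2.1 y.1)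
      ((M.law σ).map (fun ω => ω n)) := by
    rw [integrable_map_measure hm.aestronglyMeasurable (Measurable.aemeasurable (by fun_prop))]
    exact i1.sub i2
  rw [h] at i3 ⊢
  rw [Measure.comp_eq_comp_const_apply] at i3 ⊢
  rw [Kernel.integral_comp i3]
  simp only [integral_payoff_sub_meanReward_stageKernel, integral_zero]

/-- A policy that mixes `Ps` almost surely only takes actions prescribed by `Ps`. -/
theorem ae_law_of_mixes {σ : Policy S A} {Ps : Set (S → A)} (hσ : σ.Mixes Ps) (n : ℕ) :
    ∀ᵐ ω ∂(M.law σ), ∃ π ∈ Ps, (ω n).2.1 = π (ω n).1 := by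
  obtain ⟨ν, hν, h⟩ := M.exists_map_eval_law σ n
  have hp : MeasurableSet {y : Stage S A | ∃ π ∈ Ps, y.2.1 = π y.1} := by
    have : Measurable fun y : Stage S A => (y.1, y.2.1) := by fun_prop
    exact this (MeasurableSet.of_discrete (s := {p : S × A | ∃ π ∈ Ps, p.2 = π p.1}))
  refine (ae_map_iff (f := fun ω : ℕ → Stage S A => ω n)
    (Measurable.aemeasurable (by fun_prop)) hp).1 ?_
  rw [h, Measure.ae_comp_iff hp]
  refine Eventually.of_forall fun x => (M.ae_stageKernel_iff σ n x hp).2 ?_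
  filter_upwards [hσ n x.1 x.2] with a ha
  exact Eventually.of_forall fun _ => ha

theorem measurable_transError (h : S → ℝ) :
    Measurable fun z : Stage S A × Stage S A => M.transError h z.1 z.2 := by
  have : Measurable fun p : S × A × S => h p.2.2 - ∑ j, M.prob p.2.1 p.1 j * h j :=
    Measurable.of_discrete
  exact this.comp (f := fun z : Stage S A × Stage S A => (z.1.1, z.1.2.1, z.2.1)) (by fun_prop)

theorem integral_transError_stepKernel (σ : Policy S A) (n : ℕ) (h : S → ℝ)
    (x : Finset.Iic n → Stage S A) :
    ∫ y, M.transError h (x ⟨n, Finset.mem_Iic.2 le_rfl⟩) y ∂(M.stepKernel σ n x) = 0 := by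
  set z := x ⟨n, Finset.mem_Iic.2 le_rfl⟩ with hz
  -- The next state is drawn before the policy acts, so its conditional law is the transition law,
  -- whatever the policy.
  have hfst : (M.stepKernel σ n x).map Prod.fst = (M.trans z.2.1 z.1).toMeasure := by
    ext s hs
    rw [Measure.map_apply measurable_fst hs, stepKernel,
      Kernel.comp_apply' _ _ _ (measurable_fst hs)]
    have hk : ∀ w, M.stageKernel σ (n + 1) w (Prod.fst ⁻¹' s) = s.indicator 1 w.2 := fun w => by
      have := σ.markov (n + 1)
      have := fun a => M.payoff_prob a w.2
      rw [← lintegral_indicator_one (measurable_fst hs),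
        lintegral_stageKernel _ _ _ _ (measurable_one.indicator (measurable_fst hs))]
      have : ∀ (a : A) (r : ℝ), (Prod.fst ⁻¹' s).indicator (1 : Stage S A → ENNReal) (w.2, a, r) =
        s.indicator 1 w.2 := fun a r => rfl
      simp [this]
    simp only [hk]
    have hm : Measurable fun b : (Fin (n + 1) → Stage S A) × S =>
        s.indicator (1 : S → ENNReal) b.2 := (measurable_one.indicator hs).comp measurable_snd
    rw [Kernel.lintegral_deterministic_prod _ _ _ hm, lintegral_indicator_one hs]
    rfl
  have h1 : ∫ y, h y.1 ∂(M.stepKernel σ n x) = ∑ j, M.prob z.2.1 z.1 j * h j := by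
    have : ∫ y, h y.1 ∂(M.stepKernel σ n x) = ∫ j, h j ∂((M.stepKernel σ n x).map Prod.fst) :=
      (integral_map (by fun_prop) Measurable.of_discrete.aestronglyMeasurable).symm
    rw [this, hfst, PMF.integral_eq_sum]
    rfl
  simp only [transError]
  rw [integral_sub _ (integrable_const _), h1]
  · simp
  · exact Integrable.comp_measurable (f := (Prod.fst : Stage S A → S)) (g := h)
      Integrable.of_finite measurable_fst

/-- The transition errors are martingale differences. -/
theorem integral_mul_transError_law (σ : Policy S A) (n : ℕ) (h : S → ℝ)
    {g : (Finset.Iic n → Stage S A) → ℝ} (hg : Measurable g) {C : ℝ} (hC : ∀ x, |g x| ≤ C) :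
    ∫ ω, g (Preorder.frestrictLe n ω) * M.transError h (ω n) (ω (n + 1)) ∂(M.law σ) = 0 := by
  obtain ⟨K, hK⟩ := M.exists_abs_transError_le h
  -- Written as a function of the history and the next stage, the integrand can be integrated over
  -- the next stage first, where `g` is a constant factor.
  let F : (Finset.Iic n → Stage S A) × Stage S A → ℝ := fun z =>
    g z.1 * M.transError h (z.1 ⟨n, Finset.mem_Iic.2 le_rfl⟩) z.2
  have hF : Measurable F := (hg.comp measurable_fst).mul ((M.measurable_transError h).comp
    (f := fun z : (Finset.Iic n → Stage S A) × Stage S A =>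
      (z.1 ⟨n, Finset.mem_Iic.2 le_rfl⟩, z.2)) (by fun_prop))
  have hm : Measurable fun ω : ℕ → Stage S A =>
      (Preorder.frestrictLe (π := fun _ => Stage S A) n ω, ω (n + 1)) := by fun_prop
  have : IsProbabilityMeasure
      ((M.law σ).map (Preorder.frestrictLe (π := fun _ => Stage S A) n)) :=
    Measure.isProbabilityMeasure_map (Measurable.aemeasurable (by fun_prop))
  have h1 : ∫ ω, g (Preorder.frestrictLe n ω) * M.transError h (ω n) (ω (n + 1)) ∂(M.law σ) =
      ∫ z, F z ∂((M.law σ).map (fun ω => (Preorder.frestrictLe n ω, ω (n + 1)))) :=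
    (integral_map hm.aemeasurable hF.aestronglyMeasurable).symm
  rw [h1, ← map_frestrictLe_law_compProd, Measure.integral_compProd]
  · simp only [F, integral_const_mul, integral_transError_stepKernel, mul_zero, integral_zero]
  · refine Integrable.of_bound hF.aestronglyMeasurable (C * K) (Eventually.of_forall fun z => ?_)
    rw [norm_mul]
    exact mul_le_mul (hC _) (hK _ _) (norm_nonneg _) ((abs_nonneg _).trans (hC z.1))

end Law

end MDP

/-! ### Long-run averages in expectation and along trajectories -/

namespace MDP

section Optimality

variable {S A : Type*} [Fintype S] [Fintype A] [MeasurableSpace S] [MeasurableSpace A]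
  [DiscreteMeasurableSpace S] [DiscreteMeasurableSpace A] (M : MDP S A)

theorem ae_tendsto_sum_transError_div (σ : Policy S A) (h : S → ℝ) :
    ∀ᵐ ω ∂(M.law σ), Tendsto (fun n : ℕ =>
      (∑ t ∈ Finset.range n, M.transError h (ω t) (ω (t + 1))) / (n : ℝ)) atTop (𝓝 0) := by
  obtain ⟨C, hC⟩ := M.exists_abs_transError_le h
  have hm : ∀ t, Measurable fun ω : ℕ → Stage S A => M.transError h (ω t) (ω (t + 1)) := fun t =>
    (M.measurable_transError h).comp (f := fun ω : ℕ → Stage S A => (ω t, ω (t + 1)))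
      ((measurable_pi_apply t).prodMk (measurable_pi_apply (t + 1)))
  have horth : ∀ s t, s < t → ∫ ω, M.transError h (ω s) (ω (s + 1)) *
      M.transError h (ω t) (ω (t + 1)) ∂(M.law σ) = 0 := by
    intro s t hst
    -- The error at `s` involves the stages `s` and `s + 1`. As `s + 1 ≤ t`, it is a function of the
    -- history up to `t`, as the martingale property requires.
    have hg : Measurable fun x : Finset.Iic t → Stage S A => M.transError h
        (x ⟨s, Finset.mem_Iic.2 hst.le⟩) (x ⟨s + 1, Finset.mem_Iic.2 hst⟩) :=
      (M.measurable_transError h).comp (f := fun x : Finset.Iic t → Stage S A =>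
        (x ⟨s, Finset.mem_Iic.2 hst.le⟩, x ⟨s + 1, Finset.mem_Iic.2 hst⟩))
        ((measurable_pi_apply _).prodMk (measurable_pi_apply _))
    have key := M.integral_mul_transError_law σ t h hg fun x => hC _ _
    simpa only [Preorder.frestrictLe_apply] using key
  exact ae_tendsto_sum_div_of_orthogonal hm (fun t ω => hC _ _) horth

theorem integral_meanReward_sub_eq (σ : Policy S A) (g : ℝ) (h : S → ℝ) (t : ℕ) :
    ∫ ω, (ω t).2.2 ∂(M.law σ) - g = ∫ ω, M.defect g h (ω t).2.1 (ω t).1 ∂(M.law σ) +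
      (∫ ω, h (ω t).1 ∂(M.law σ) - ∫ ω, h (ω (t + 1)).1 ∂(M.law σ)) := by
  have hi : ∀ (f : S × A → ℝ) (t : ℕ),
      Integrable (fun ω : ℕ → Stage S A => f ((ω t).1, (ω t).2.1)) (M.law σ) := fun f t =>
    integrable_comp_state_action _ (by fun_prop) f
  have i0 := hi (fun p => M.meanReward p.2 p.1) t
  have i1 := hi (fun p => M.defect g h p.2 p.1) t
  have i2 := hi (fun p => h p.1) t
  have i3 := hi (fun p => h p.1) (t + 1)
  have i4 : Integrable (fun ω : ℕ → Stage S A => M.transError h (ω t) (ω (t + 1))) (M.law σ) :=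
    i3.sub (hi (fun p => ∑ j, M.prob p.2 p.1 j * h j) t)
  -- The weight 1 gives the error mean zero.
  have h0 := M.integral_mul_transError_law σ t h (g := fun _ => 1) measurable_const (C := 1)
    (by simp)
  simp only [one_mul] at h0
  have e1 : ∫ ω, (M.meanReward (ω t).2.1 (ω t).1 - g) ∂(M.law σ) =
      ∫ ω, M.meanReward (ω t).2.1 (ω t).1 ∂(M.law σ) - g := by
    rw [integral_sub i0 (integrable_const _)]; simp
  have e2 : ∫ ω, (M.defect g h (ω t).2.1 (ω t).1 + M.transError h (ω t) (ω (t + 1)) +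
      (h (ω t).1 - h (ω (t + 1)).1)) ∂(M.law σ) = _ := integral_add (i1.add i4) (i2.sub i3)
  have e3 : ∫ ω, (M.defect g h (ω t).2.1 (ω t).1 + M.transError h (ω t) (ω (t + 1)))
      ∂(M.law σ) = _ := integral_add i1 i4
  have e4 : ∫ ω, (h (ω t).1 - h (ω (t + 1)).1) ∂(M.law σ) = _ := integral_sub i2 i3
  rw [integral_payoff_law, ← e1]
  simp_rw [fun ω : ℕ → Stage S A => M.meanReward_sub_eq g h (ω t) (ω (t + 1))]
  rw [e2, ← e4, ← add_zero (∫ ω, M.defect g h (ω t).2.1 (ω t).1 ∂(M.law σ)), ← h0]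
  exact congrArg (· + _) e3

theorem expectedAverage_eq (σ : Policy S A) (n : ℕ) :
    M.expectedAverage σ n = (∑ t ∈ Finset.range n, ∫ ω, (ω t).2.2 ∂(M.law σ)) / n := by
  rw [expectedAverage, integral_div, integral_finsetSum _ fun t _ => M.integrable_payoff_law σ t]

theorem expectedAverage_sub_eq (σ : Policy S A) (g : ℝ) (h : S → ℝ) {n : ℕ} (hn : 0 < n) :
    M.expectedAverage σ n - g =
      (∑ t ∈ Finset.range n, ∫ ω, M.defect g h (ω t).2.1 (ω t).1 ∂(M.law σ)) / n +
      (∫ ω, h (ω 0).1 ∂(M.law σ) - ∫ ω, h (ω n).1 ∂(M.law σ)) / n := by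
  have hn0 : (n : ℝ) ≠ 0 := by exact_mod_cast hn.ne'
  rw [← Finset.sum_range_sub' (fun t => ∫ ω, h (ω t).1 ∂(M.law σ)), ← add_div,
    ← Finset.sum_add_distrib, ← Finset.sum_congr rfl fun t _ =>
      M.integral_meanReward_sub_eq σ g h t, expectedAverage_eq, Finset.sum_sub_distrib]
  simp
  field_simp

theorem tendsto_integral_sub_div (σ : Policy S A) (h : S → ℝ) :
    Tendsto (fun n : ℕ => (∫ ω, h (ω 0).1 ∂(M.law σ) - ∫ ω, h (ω n).1 ∂(M.law σ)) / (n : ℝ))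
      atTop (𝓝 0) := by
  obtain ⟨K, hK⟩ := exists_abs_le h
  refine tendsto_sub_div_of_bounded (u := fun n => ∫ ω, h (ω n).1 ∂(M.law σ)) (K := K) fun n => ?_
  have := norm_integral_le_of_norm_le_const (μ := M.law σ)
    (f := fun ω : ℕ → Stage S A => h (ω n).1) (Eventually.of_forall fun ω => hK (ω n).1)
  simpa using this

/-- Nonpositive defects can only lower the expected average, leaving the vanishing boundary term as
the only possible excess over `g`. -/
theorem eventually_expectedAverage_lt (σ : Policy S A) {g : ℝ} {h : S → ℝ}
    (hle : ∀ a i, M.defect g h a i ≤ 0) {ε : ℝ} (hε : 0 < ε) :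
    ∀ᶠ n in atTop, M.expectedAverage σ n < g + ε := by
  filter_upwards [(M.tendsto_integral_sub_div σ h).eventually_lt_const hε, eventually_gt_atTop 0]
    with n h1 hn
  have h2 := M.expectedAverage_sub_eq σ g h hn
  have h3 : (∑ t ∈ Finset.range n, ∫ ω, M.defect g h (ω t).2.1 (ω t).1 ∂(M.law σ)) / (n : ℝ) ≤ 0 :=
    div_nonpos_of_nonpos_of_nonneg
      (Finset.sum_nonpos fun t _ => integral_nonpos fun ω => hle _ _) (Nat.cast_nonneg n)
  linarith

theorem tendsto_expectedAverage (σ : Policy S A) {g : ℝ} {h : S → ℝ}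
    (h0 : ∀ t : ℕ, ∀ᵐ ω ∂(M.law σ), M.defect g h (ω t).2.1 (ω t).1 = 0) :
    Tendsto (M.expectedAverage σ) atTop (𝓝 g) := by
  have h1 := (M.tendsto_integral_sub_div σ h).add_const g
  rw [zero_add] at h1
  refine h1.congr' ?_
  filter_upwards [eventually_gt_atTop 0] with n hn
  have h2 := M.expectedAverage_sub_eq σ g h hn
  rw [Finset.sum_eq_zero fun t _ => integral_eq_zero_of_ae (h0 t), zero_div, zero_add] at h2
  rw [← h2, sub_add_cancel]

theorem ae_tendsto_pathAverage (σ : Policy S A) {g : ℝ} {h : S → ℝ}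
    (h0 : ∀ t : ℕ, ∀ᵐ ω ∂(M.law σ), M.defect g h (ω t).2.1 (ω t).1 = 0) :
    ∀ᵐ ω ∂(M.law σ), Tendsto (M.pathAverage ω) atTop (𝓝 g) := by
  obtain ⟨K, hK⟩ := exists_abs_le h
  -- Times are countable, so almost every trajectory has zero defect at all of them.
  filter_upwards [ae_all_iff.2 h0, M.ae_tendsto_sum_transError_div σ h] with ω hω h1
  have h2 := (h1.add (tendsto_sub_div_of_bounded (u := fun n => h (ω n).1)
    fun n => hK _)).add_const g
  rw [add_zero, zero_add] at h2
  refine h2.congr' ?_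
  filter_upwards [eventually_gt_atTop 0] with n hn
  have hn0 : (n : ℝ) ≠ 0 := by exact_mod_cast hn.ne'
  have h3 : ∑ t ∈ Finset.range n, M.meanReward (ω t).2.1 (ω t).1 - n * g =
      ∑ t ∈ Finset.range n, M.transError h (ω t) (ω (t + 1)) + (h (ω 0).1 - h (ω n).1) := by
    rw [← Finset.sum_range_sub' (fun t => h (ω t).1), ← Finset.sum_add_distrib]
    have : ∑ t ∈ Finset.range n, (M.meanReward (ω t).2.1 (ω t).1 - g) =
        ∑ t ∈ Finset.range n, (M.transError h (ω t) (ω (t + 1)) +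
          (h (ω t).1 - h (ω (t + 1)).1)) :=
      Finset.sum_congr rfl fun t _ => by
        rw [M.meanReward_sub_eq g h (ω t) (ω (t + 1)), hω t, zero_add]
    rw [← this, Finset.sum_sub_distrib]
    simp
  rw [← add_div, ← h3, pathAverage]
  field_simp
  ring

end Optimality

end MDP

theorem theorem2 {S A : Type*} [Fintype S] [Fintype A]
    [MeasurableSpace S] [MeasurableSpace A]
    [DiscreteMeasurableSpace S] [DiscreteMeasurableSpace A]
    (M : MDP S A) (hM : M.IsUnichain)
    (Ps : Set (S → A)) (hPs : ∀ π ∈ Ps, M.IsOptimal π)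
    (σ : Policy S A) (hσ : σ.Mixes Ps) :
    M.IsOptimalPolicy σ ∧
      ∀ᵐ ω ∂(M.law σ), Tendsto (M.pathAverage ω) atTop (𝓝 M.optimalValue) := by
  -- The existence of a policy forces an action to exist: its law is a probability measure, so there
  -- is a trajectory.
  obtain ⟨ω₀⟩ : Nonempty (ℕ → Stage S A) := (M.law σ).nonempty_of_neZero
  have : Nonempty A := ⟨(ω₀ 0).2.1⟩
  obtain ⟨h, hle, heq⟩ := M.exists_defect_nonpos hM
  have h0 : ∀ t : ℕ, ∀ᵐ ω ∂(M.law σ), M.defect M.optimalValue h (ω t).2.1 (ω t).1 = 0 :=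
    fun t => by
      filter_upwards [M.ae_law_of_mixes hσ t] with ω ⟨π, hπ, hω⟩
      rw [hω]
      exact heq π (hPs π hπ) _
  exact ⟨⟨⟨M.integrable_payoff_law σ, M.tendsto_expectedAverage σ h0⟩,
    fun σ' ε hε => M.eventually_expectedAverage_lt σ' hle hε⟩, M.ae_tendsto_pathAverage σ h0⟩
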